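/- **Setting.** Let $V$ be a finite set of qubits. A *stabilizer graph* $G$ on $V$ is a simple undirected graph with node set $V$ together with three arbitrary subsets of $V$: the set of nodes with a (self) loop, the set $\mathcal H$ of *hollow* nodes (all others are *solid*), and the set $\mathcal Z$ of nodes with a (minus) *sign*. $\mathcal N(j)$ denotes the set of neighbors of $j$; a node is never its own neighbor, even if it has a loop. The graph represents the state $|\psi_G\rangle$ obtained from $|0\rangle^{\otimes V}$ by applying the Hadamard gate $H=\frac1{\sqrt2}\begin{pmatrix}1&1\\1&-1\end{pmatrix}$ to every qubit, then a controlled-$Z$ gate along every edge, and then, at each node, $Z$ if it has a sign, followed by $S=\mathrm{diag}(1,i)$ if it has a loop, followed by $H$ if it is hollow. Let $M=\bigotimes_{j\in V}M_j$ with every $M_j\in\{I,Z\}$ (a *$Z$-type Pauli-product measurement*), and let $\mathcal M=\{j: M_j\neq I\}$ be the set of measured nodes, $\mathcal M_S=\mathcal M\setminus\mathcal H$, $\mathcal M_H=\mathcal M\cap\mathcal H$, $$\mathcal M_{SE}=\{j\in\mathcal M_S : |\mathcal M_H\cap\mathcal N(j)|\text{ is even}\},\qquad b=|\mathcal M_H\cap\mathcal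 Z|.$$ For $m\in\{0,1\}$ put $P_m=\frac12(I+(-1)^mM)$; measuring $M$ on $|\psi\rangle$ gives the outcome $(-1)^m$ with probability $\langle\psi|P_m|\psi\rangle$, and then the post-measurement state is $P_m|\psi\rangle/\sqrt{\langle\psi|P_m|\psi\rangle}$. **Theorem.** Suppose that the measured hollow nodes of $G$ have no loops and are connected neither to one another nor to unmeasured nodes, and let $M$ be measured on $|\psi\rangle=|\psi_G\rangle$. (a) The outcome is $(-1)^b$ with probability $1$ if and only if $\mathcal M_{SE}=\varnothing$; in that case the outcome $(-1)^{b+1}$ has probability $0$ and the state is unchanged by the measurement. (b) If $\mathcal M_{SE}\ne\varnothing$, then each of the two outcomes has probability $\frac12$. Moreover, for each outcome $(-1)^m$ and for every node $p\in\mathcal M_{SE}$ (the *chosen* node), the post-measurement state is represented, up to a global phase, by the stabilizer graph obtained from $G$ by performing the following steps in order, where $\mathcal M_{SE}$ and $b$ are always those of the original graph: 1. For each neighbor of $p$, complement all of its edges to the nodes of $\mathcal M_{SE}\setminus\{p\}$ (other than itself), i.e. remove the edge if it is present and add it otherwise; an edge reached from both of its ends is complemented twice. 2. If $p$ has no sign,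 flip the signs of all neighbors of $p$ that are in $\mathcal M_{SE}$; if $p$ has a sign, remove that sign and flip the signs of all nodes of $\mathcal M_{SE}\setminus\{p\}$ that are not neighbors of $p$. Then, if $m\not\equiv b\pmod 2$, flip the signs of $p$ and of all its neighbors. 3. Remove all edges at $p$, then connect $p$ to all nodes of $\mathcal M_{SE}\setminus\{p\}$, and make $p$ hollow. 4. If $p$ has a loop: remove that loop; complement all edges between neighbors of $p$; *advance* the loop of every neighbor of $p$ (if the neighbor has no loop, add one; if it has one, remove it and flip the sign of the neighbor); and, if $m\not\equiv b\pmod 2$, flip the signs of all nodes of $\mathcal M_{SE}\setminus\{p\}$. -/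

import Mathlib

open scoped Matrix symmDiff

/-! ## Qubits labelled by `V`: states are vectors indexed by bit assignments `V → Fin 2` -/

/-- Pure (not necessarily normalized) state vectors of qubits labelled by `V`, written in the
standard basis `|x⟩`, `x : V → Fin 2`. -/
abbrev QState (V : Type*) := (V → Fin 2) → ℂ

/-- Operators on the qubits labelled by `V`, as matrices in the standard basis. -/
abbrev QOp (V : Type*) := Matrix (V → Fin 2) (V → Fin 2) ℂ

/-- The tensor product `⨂ j, A j` of one-qubit operators. -/
def tensorOp {V : Type*} [Fintype V] (A : V → Matrix (Fin 2) (Fin 2) ℂ) : QOp V :=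
  Matrix.of fun x y => ∏ j, A j (x j) (y j)

/-- The state `|0⟩ ⊗ ⋯ ⊗ |0⟩`. -/
def zeroState (V : Type*) [Fintype V] : QState V :=
  Pi.single (fun _ => 0) 1

namespace Gate

/-- Pauli `X`. -/
def X : Matrix (Fin 2) (Fin 2) ℂ := !![0, 1; 1, 0]

/-- Pauli `Y`. -/
def Y : Matrix (Fin 2) (Fin 2) ℂ := !![0, -Complex.I; Complex.I, 0]

/-- Pauli `Z`. -/
def Z : Matrix (Fin 2) (Fin 2) ℂ := !![1, 0; 0, -1]

/-- The phase gate `S`. -/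
def S : Matrix (Fin 2) (Fin 2) ℂ := !![1, 0; 0, Complex.I]

/-- The Hadamard gate `H`. -/
noncomputable def H : Matrix (Fin 2) (Fin 2) ℂ :=
  ((1 / Real.sqrt 2 : ℝ) : ℂ) • !![1, 1; 1, -1]

/-- The controlled-`Z` gate between the qubits `j` and `k`: it multiplies `|x⟩` by `-1` exactly
when both `x j` and `x k` are `1`. -/
def CZ {V : Type*} [Fintype V] [DecidableEq V] (j k : V) : QOp V :=
  Matrix.diagonal fun x => if x j = 1 ∧ x k = 1 then -1 else 1

theorem CZ_symm {V : Type*} [Fintype V] [DecidableEq V] (j k : V) :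
    (CZ j k : QOp V) = CZ k j := by
  simp only [CZ, and_comm]

/-- The controlled-`Z` gate along an unordered pair. -/
def CZedge {V : Type*} [Fintype V] [DecidableEq V] (e : Sym2 V) : QOp V :=
  Sym2.lift ⟨CZ, CZ_symm⟩ e

theorem CZedge_commute {V : Type*} [Fintype V] [DecidableEq V] (e f : Sym2 V) :
    Commute (CZedge e : QOp V) (CZedge f) := by
  induction e with
  | _ a b =>
    induction f with
    | _ c d => exact Matrix.commute_diagonal _ _

end Gate

/-! ## Projective measurements -/

/-- The projector `P_m = (I + (-1)^m A) / 2` onto the outcome `(-1)^m` of a measurement of an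
observable `A` with `A² = I`. Only the parity of `m` matters. -/
noncomputable def outcomeProj {V : Type*} [DecidableEq V] [Fintype V] (A : QOp V) (m : ℕ) :
    QOp V :=
  (1 / 2 : ℂ) • (1 + (-1 : ℂ) ^ m • A)

/-- The probability `⟨ψ|P_m|ψ⟩` of the outcome `(-1)^m` (a real number, as `P_m` is Hermitian). -/
noncomputable def outcomeProb {V : Type*} [DecidableEq V] [Fintype V] (A : QOp V) (ψ : QState V)
    (m : ℕ) : ℝ :=
  (star ψ ⬝ᵥ (outcomeProj A m *ᵥ ψ)).re

/-- The post-measurement state `P_m|ψ⟩ / √⟨ψ|P_m|ψ⟩` after the outcome `(-1)^m`. -/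
noncomputable def postState {V : Type*} [DecidableEq V] [Fintype V] (A : QOp V) (ψ : QState V)
    (m : ℕ) : QState V :=
  (((Real.sqrt (outcomeProb A ψ m))⁻¹ : ℝ) : ℂ) • (outcomeProj A m *ᵥ ψ)

/-- Two vectors describe the same physical state: they differ by a global phase. -/
def SameState {V : Type*} (φ ψ : QState V) : Prop :=
  ∃ c : ℂ, ‖c‖ = 1 ∧ φ = c • ψ

/-! ## Pauli products -/

/-- Labels of the one-qubit Pauli operators. -/
inductive Pauli
  | I
  | X
  | Y
  | Z
  deriving DecidableEq

/-- The matrix of a Pauli label. -/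
def Pauli.toMatrix : Pauli → Matrix (Fin 2) (Fin 2) ℂ
  | .I => 1
  | .X => Gate.X
  | .Y => Gate.Y
  | .Z => Gate.Z

/-- A Pauli-product measurement `M = ⨂ j, M j`, given by its tensor factors. -/
abbrev PauliProduct (V : Type*) := V → Pauli

namespace PauliProduct

variable {V : Type*} [Fintype V] [DecidableEq V]

/-- The observable `⨂ j, M j`. -/
def toOp (M : PauliProduct V) : QOp V := tensorOp fun j => (M j).toMatrix

/-- The measurement is of `Z` type: every tensor factor is `I` or `Z`. -/
def IsZType (M : PauliProduct V) : Prop := ∀ j, M j = Pauli.I ∨ M j = Pauli.Z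

/-- The set of measured nodes. -/
def measured (M : PauliProduct V) : Finset V := Finset.univ.filter fun j => M j ≠ Pauli.I

end PauliProduct

/-! ## Stabilizer graphs -/

/-- A stabilizer graph: a simple graph whose nodes may carry a self loop, may be hollow (the
others are solid), and may carry a minus sign, in any combination. Self loops are kept apart from
the edges, so that a node is never its own neighbor. -/
structure StabilizerGraph (V : Type*) where
  graph : SimpleGraph V
  loop : Finset V
  hollow : Finset V
  sign : Finset V

namespace StabilizerGraph

variable {V : Type*} [Fintype V] [DecidableEq V]

/-- The set of edges of the graph. -/
noncomputable def edges (G : StabilizerGraph V) : Finset (Sym2 V) :=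
  G.graph.edgeSet.toFinite.toFinset

open scoped Classical in
/-- The neighborhood of a node. -/
noncomputable def nbrs (G : StabilizerGraph V) (j : V) : Finset V :=
  Finset.univ.filter fun k => G.graph.Adj j k

/-- The terminal one-qubit gates at a node: `Z` for a sign, then `S` for a loop, then `H` for a
hollow node. -/
noncomputable def nodeGate (G : StabilizerGraph V) (j : V) : Matrix (Fin 2) (Fin 2) ℂ :=
  (if j ∈ G.hollow then Gate.H else 1) * (if j ∈ G.loop then Gate.S else 1) *
    (if j ∈ G.sign then Gate.Z else 1)

/-- The graph-form circuit: Hadamard gates on all qubits, then a controlled-`Z` gate along every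
edge, then the terminal gates `Z`, `S`, `H` dictated by the decorations. -/
noncomputable def circuit (G : StabilizerGraph V) : QOp V :=
  tensorOp G.nodeGate *
    G.edges.noncommProd Gate.CZedge (fun e _ f _ _ => Gate.CZedge_commute e f) *
    tensorOp fun _ => Gate.H

/-- The stabilizer state represented by the graph. -/
noncomputable def state (G : StabilizerGraph V) : QState V :=
  G.circuit *ᵥ zeroState V

/-! ### The sets attached to a measurement -/

/-- The measured solid nodes. -/
def MS (G : StabilizerGraph V) (M : PauliProduct V) : Finset V := M.measured \ G.hollow

/-- The measured hollow nodes. -/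
def MH (G : StabilizerGraph V) (M : PauliProduct V) : Finset V := M.measured ∩ G.hollow

/-- The measured solid nodes with an even number of measured hollow neighbors. -/
noncomputable def MSE (G : StabilizerGraph V) (M : PauliProduct V) : Finset V :=
  (G.MS M).filter fun j => Even (G.MH M ∩ G.nbrs j).card

/-- The number of measured hollow nodes with a sign. -/
def signCount (G : StabilizerGraph V) (M : PauliProduct V) : ℕ := (G.MH M ∩ G.sign).card

/-- The graph is simplified for the measurement: measured hollow nodes have no loops and are
connected neither to one another nor to unmeasured nodes. -/
def IsSimplifiedFor (G : StabilizerGraph V) (M : PauliProduct V) : Prop :=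
  ∀ j ∈ G.MH M, j ∉ G.loop ∧ (∀ k ∈ G.MH M, ¬ G.graph.Adj j k) ∧
    ∀ k ∉ M.measured, ¬ G.graph.Adj j k

/-! ### Operations on stabilizer graphs -/

/-- Flip the signs of the nodes in `T`. -/
def flipSigns (G : StabilizerGraph V) (T : Finset V) : StabilizerGraph V :=
  { G with sign := G.sign ∆ T }

/-- Advance the loops of the nodes in `T`: a loop is added where there was none; where there was
one, it is removed and the sign is flipped. -/
def advanceLoops (G : StabilizerGraph V) (T : Finset V) : StabilizerGraph V :=
  { G with
    loop := G.loop ∆ T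
    sign := G.sign ∆ (G.loop ∩ T) }

/-- Local complementation on the node `p`: complement all edges between neighbors of `p`. -/
def localComplement (G : StabilizerGraph V) (p : V) : StabilizerGraph V :=
  { G with
    graph :=
      { Adj := fun j k => j ≠ k ∧
          Xor (G.graph.Adj j k) (G.graph.Adj p j ∧ G.graph.Adj p k)
        symm := ⟨fun j k h => ⟨h.1.symm, by
          have h2 := h.2
          rw [G.graph.adj_comm, and_comm (a := G.graph.Adj p j)] at h2
          exact h2⟩⟩
        loopless := ⟨fun j h => h.1 rfl⟩ } }

/-- For each neighbor of `p`, complement all of its edges to (other) nodes of `T`. An edge both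
of whose ends are neighbors of `p` in `T` is complemented twice. -/
def complementNbrsTo (G : StabilizerGraph V) (p : V) (T : Finset V) : StabilizerGraph V :=
  { G with
    graph :=
      { Adj := fun j k => j ≠ k ∧
          Xor (G.graph.Adj j k)
            (Xor (G.graph.Adj p j ∧ k ∈ T) (G.graph.Adj p k ∧ j ∈ T))
        symm := ⟨fun j k h => ⟨h.1.symm, by
          have h2 := h.2
          rw [G.graph.adj_comm, xor_comm (G.graph.Adj p j ∧ k ∈ T)] at h2
          exact h2⟩⟩
        loopless := ⟨fun j h => h.1 rfl⟩ } }

/-- Remove all edges involving `p`, then connect `p` to all nodes of `T` (other than `p`). -/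
def reconnect (G : StabilizerGraph V) (p : V) (T : Finset V) : StabilizerGraph V :=
  { G with
    graph :=
      { Adj := fun j k => (j ≠ p ∧ k ≠ p ∧ G.graph.Adj j k) ∨
          (j = p ∧ k ≠ p ∧ k ∈ T) ∨ (k = p ∧ j ≠ p ∧ j ∈ T)
        symm := ⟨fun j k h => by
          rcases h with ⟨h1, h2, h3⟩ | h | h
          · exact Or.inl ⟨h2, h1, h3.symm⟩
          · exact Or.inr (Or.inr h)
          · exact Or.inr (Or.inl h)⟩
        loopless := ⟨fun j h => by
          rcases h with ⟨_, _, h⟩ | ⟨h1, h2, _⟩ | ⟨h1, h2, _⟩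
          · exact G.graph.loopless.irrefl j h
          · exact h2 h1
          · exact h2 h1⟩ } }

/-! ### The post-measurement graph

`p` is the chosen node, `T` the set of measured solid nodes with an even number of measured hollow
neighbors in the original graph, and `flipped` says that `m` and `b` have different parity. -/

/-- Step 1: for each neighbor of the chosen node, complement all of its edges to unchosen nodes
in `T`. -/
def step1 (G : StabilizerGraph V) (p : V) (T : Finset V) : StabilizerGraph V :=
  G.complementNbrsTo p (T.erase p)

/-- First part of step 2: if the chosen node has no sign, flip the signs of its neighbors in `T`;
otherwise remove its sign and flip the signs of the other nodes in `T` that are not its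
neighbors. -/
noncomputable def step2a (G : StabilizerGraph V) (p : V) (T : Finset V) : StabilizerGraph V :=
  if p ∉ G.sign then G.flipSigns (G.nbrs p ∩ T)
  else { G with sign := G.sign.erase p }.flipSigns (T.erase p \ G.nbrs p)

open scoped Classical in
/-- Second part of step 2: if `m` and `b` have different parity, flip the signs of the chosen node
and of all its neighbors. -/
noncomputable def step2b (G : StabilizerGraph V) (p : V) (flipped : Prop) : StabilizerGraph V :=
  if flipped then G.flipSigns (insert p (G.nbrs p)) else G

/-- Step 3: remove all edges involving the chosen node, connect it to all the other nodes in `T`,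
and make it hollow. -/
def step3 (G : StabilizerGraph V) (p : V) (T : Finset V) : StabilizerGraph V :=
  { G.reconnect p (T.erase p) with hollow := insert p G.hollow }

/-- The graph part of step 4 for a chosen node with a loop: remove the loop, perform local
complementation on the node, and advance the loops of its neighbors. -/
noncomputable def step4a (G : StabilizerGraph V) (p : V) : StabilizerGraph V :=
  ({ G with loop := G.loop.erase p }.localComplement p).advanceLoops (G.nbrs p)

open scoped Classical in
/-- Step 4: if the chosen node has a loop, do `step4a` and, if `m` and `b` have different parity,
flip the signs of the unchosen nodes in `T`. -/
noncomputable def step4 (G : StabilizerGraph V) (p : V) (T : Finset V) (flipped : Prop) :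
    StabilizerGraph V :=
  if p ∈ G.loop then
    if flipped then (G.step4a p).flipSigns (T.erase p) else G.step4a p
  else G

/-- The graph obtained from `G` by steps 1–4 for the measurement `M` with outcome `(-1)^m` and
chosen node `p`. -/
noncomputable def measureGraph (G : StabilizerGraph V) (M : PauliProduct V) (p : V) (m : ℕ) :
    StabilizerGraph V :=
  ((((G.step1 p (G.MSE M)).step2a p (G.MSE M)).step2b p (¬ m ≡ G.signCount M [MOD 2])).step3 p
    (G.MSE M)).step4 p (G.MSE M) (¬ m ≡ G.signCount M [MOD 2])

end StabilizerGraph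

/-! ## The quadratic form of a stabilizer graph -/

/-! Up to Hadamards on the hollow nodes, the amplitude of a graph state at a bit assignment `y` is
`2^(-n/2) * i^q(y)`. Here `q` is the `ℤ/4`-valued form `form`: loops contribute `y_j`, signs `2
y_j`, and edges `2 y_j y_k`, since each edge is counted in both orders (`state_eq`).

Moving `M` past these Hadamards turns `Z` into `X` on the measured hollow nodes, which flips their
bits. For a simplified graph the resulting change of `q` is linear, and together with the signs from
the measured solid nodes it makes `M` multiplication by `(-1)^(b + ∑_{MSE} y_j)` (`form_flipBits`,
`toOp_mulVec_state`). Hence `P_m` keeps exactly the `y` whose parity on `MSE` is `m + b`. The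
amplitudes have constant modulus, so the probabilities reduce to the sum of a character, which
vanishes unless `MSE` is empty.

For the new graph, put `x = y_p`, let `u` and `n` be the sums of `y` over `MSE \ {p}` and over the
neighbors of `p`, and let `s` be the parity of `m + b`. Since `p` is now hollow, its Hadamard sums
over a bit `z`. The four steps are designed so that the new form with `z` at `p` equals `q(y) + 2z(s
+ u) + K`, where `K` does not involve `z` (`form_measureGraph_update`). Summing over `z` produces
the factor `1 + (-1)^(x + s + u)`, the same parity constraint as `P_m`. Wherever this factor is
nonzero, `K` is a constant modulo 4 (`phase_exponent_eq`), which is the global phase. -/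

/-- The sum of the entries of `b` at the nodes in `T`. -/
def bitSum {V : Type*} (T : Finset V) (b : V → ZMod 4) : ZMod 4 := ∑ j ∈ T, b j

theorem sum_ite_mem_mul {V : Type*} [Fintype V] [DecidableEq V] (T : Finset V) (b : V → ZMod 4) :
    ∑ j, (if j ∈ T then 1 else 0) * b j = bitSum T b := by
  simp [bitSum]

theorem bitSum_sdiff {V : Type*} [DecidableEq V] (S T : Finset V) (b : V → ZMod 4) :
    bitSum (S \ T) b = bitSum S b - bitSum (T ∩ S) b := by
  rw [eq_sub_iff_add_eq, bitSum, bitSum, bitSum, Finset.inter_comm]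
  exact (add_comm _ _).trans (Finset.sum_inter_add_sum_sdiff S T b)

theorem bitSum_insert {V : Type*} [DecidableEq V] {p : V} {T : Finset V} (hp : p ∉ T)
    (b : V → ZMod 4) : bitSum (insert p T) b = b p + bitSum T b :=
  Finset.sum_insert hp

theorem bitSum_update {V : Type*} [DecidableEq V] {p : V} {T : Finset V} (hp : p ∉ T)
    (b : V → ZMod 4) (z : ZMod 4) : bitSum T (Function.update b p z) = bitSum T b :=
  Finset.sum_congr rfl fun j hj => Function.update_of_ne (by rintro rfl; exact hp hj) _ _

/-- Changing the coefficients of a quadratic form by symmetric even amounts off the diagonal does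
not affect its values modulo 4. -/
theorem sum_sum_eq_of_two_mul_eq {V : Type*} [Fintype V] [DecidableEq V] (f g : V → V → ZMod 4)
    (hf : ∀ j k, f j k = f k j) (hg : ∀ j k, g j k = g k j)
    (h : ∀ j k, j ≠ k → 2 * f j k = 2 * g j k) {b : V → ZMod 4} (hb : ∀ j, b j * b j = b j) :
    ∑ j, ∑ k, f j k * (b j * b k) =
      ∑ j, ∑ k, g j k * (b j * b k) + ∑ j, (f j j - g j j) * b j := by
  -- Off the diagonal, the terms at `(j, k)` and `(k, j)` together carry `2 * (f - g)`, which is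
  -- zero, so swapping is a cancelling involution.
  have h0 : ∑ x : V × V, (if x.1 = x.2 then 0 else (f x.1 x.2 - g x.1 x.2) * (b x.1 * b x.2)) =
      0 := by
    refine Finset.sum_involution (fun x _ => x.swap) ?_ ?_ (fun _ _ => Finset.mem_univ _)
      (fun _ _ => rfl)
    · rintro ⟨j, k⟩ _
      by_cases hjk : j = k
      · simp [hjk]
      · simp only [Prod.swap, hjk, Ne.symm hjk, if_false, hf k j, hg k j]
        linear_combination b j * b k * h j k hjk
    · rintro ⟨j, k⟩ _ hne heq
      apply hne
      simp only [Prod.swap, Prod.mk.injEq] at heq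
      simp [heq.2]
  have h1 : ∀ j, ∑ k, f j k * (b j * b k) = ∑ k, g j k * (b j * b k) +
      ∑ k, (if j = k then 0 else (f j k - g j k) * (b j * b k)) + (f j j - g j j) * b j := by
    intro j
    have h2 : (f j j - g j j) * b j =
        ∑ k, if j = k then (f j k - g j k) * (b j * b k) else 0 := by
      simp [hb]
    rw [h2, ← Finset.sum_add_distrib, ← Finset.sum_add_distrib]
    refine Finset.sum_congr rfl fun k _ => ?_
    split_ifs <;> ring
  rw [Fintype.sum_prod_type] at h0
  simp only [h1, Finset.sum_add_distrib]
  simp only at h0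
  rw [h0, add_zero]

theorem sum_sum_mul_mul {V : Type*} [Fintype V] (u v b : V → ZMod 4) :
    ∑ j, ∑ k, u j * v k * (b j * b k) = (∑ j, u j * b j) * ∑ k, v k * b k := by
  rw [Finset.sum_mul_sum]
  exact Finset.sum_congr rfl fun j _ => Finset.sum_congr rfl fun k _ => by ring

open scoped Classical in
/-- The truth value of a proposition, as a number. -/
noncomputable def truthBit (P : Prop) : ZMod 4 := if P then 1 else 0

theorem truthBit_true : truthBit True = 1 := by simp [truthBit]

theorem truthBit_false : truthBit False = 0 := by simp [truthBit]

namespace StabilizerGraph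

/-- The entries of the adjacency matrix. -/
noncomputable def adjBit {V : Type*} (G : StabilizerGraph V) (j k : V) : ZMod 4 :=
  truthBit (G.graph.Adj j k)

theorem adjBit_comm {V : Type*} (G : StabilizerGraph V) (j k : V) : G.adjBit j k = G.adjBit k j := by
  rw [adjBit, adjBit, G.graph.adj_comm]

theorem adjBit_self {V : Type*} (G : StabilizerGraph V) (j : V) : G.adjBit j j = 0 := by
  simp [adjBit, truthBit_false]

theorem mem_nbrs {V : Type*} [Fintype V] (G : StabilizerGraph V) (j k : V) : k ∈ G.nbrs j ↔ G.graph.Adj j k := by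
  simp [nbrs]

theorem notMem_nbrs_self {V : Type*} [Fintype V] (G : StabilizerGraph V) (p : V) : p ∉ G.nbrs p := by
  simp [mem_nbrs]

variable {V : Type*} [Fintype V] [DecidableEq V]

theorem adjBit_eq_ite (G : StabilizerGraph V) (j k : V) :
    G.adjBit j k = if k ∈ G.nbrs j then 1 else 0 := by
  by_cases h : G.graph.Adj j k <;> simp [adjBit, truthBit_true, truthBit_false, mem_nbrs, h]

/-- The linear coefficient at a node: `1` for a loop and `2` for a sign. -/
def nodeBit (G : StabilizerGraph V) (j : V) : ZMod 4 :=
  (if j ∈ G.loop then 1 else 0) + 2 * (if j ∈ G.sign then 1 else 0)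

/-- The exponent of `i` in the amplitudes of the graph state before the final Hadamard gates. -/
noncomputable def form (G : StabilizerGraph V) (b : V → ZMod 4) : ZMod 4 :=
  ∑ j, G.nodeBit j * b j + ∑ j, ∑ k, G.adjBit j k * (b j * b k)

/-! ### Effect of each graph operation on the form -/

theorem form_eq_of_nodeBit (G G' : StabilizerGraph V) (hg : G'.graph = G.graph)
    (c : V → ZMod 4) (h : ∀ j, G'.nodeBit j = G.nodeBit j + c j) (b : V → ZMod 4) :
    G'.form b = G.form b + ∑ j, c j * b j := by
  have ha : ∀ j k, G'.adjBit j k = G.adjBit j k := by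
    intro j k; rw [adjBit, adjBit, hg]
  simp only [form, ha, h, add_mul, Finset.sum_add_distrib]
  ring

theorem form_flipSigns (G : StabilizerGraph V) (T : Finset V) (b : V → ZMod 4) :
    (G.flipSigns T).form b = G.form b + 2 * bitSum T b := by
  rw [form_eq_of_nodeBit G (G.flipSigns T) rfl (fun j => 2 * if j ∈ T then 1 else 0),
    ← sum_ite_mem_mul, Finset.mul_sum]
  · simp only [mul_assoc]
  · intro j
    by_cases h1 : j ∈ G.sign <;> by_cases h2 : j ∈ T <;> by_cases h3 : j ∈ G.loop <;>
      simp [nodeBit, flipSigns, Finset.mem_symmDiff, h1, h2, h3] <;> decide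

theorem form_advanceLoops (G : StabilizerGraph V) (T : Finset V) (b : V → ZMod 4) :
    (G.advanceLoops T).form b = G.form b + bitSum T b := by
  rw [form_eq_of_nodeBit G (G.advanceLoops T) rfl (fun j => if j ∈ T then 1 else 0),
    ← sum_ite_mem_mul]
  intro j
  by_cases h1 : j ∈ G.sign <;> by_cases h2 : j ∈ T <;> by_cases h3 : j ∈ G.loop <;>
    simp [nodeBit, advanceLoops, Finset.mem_symmDiff, h1, h2, h3] <;> decide

theorem form_eraseSign (G : StabilizerGraph V) {p : V} (hp : p ∈ G.sign) (b : V → ZMod 4) :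
    ({ G with sign := G.sign.erase p } : StabilizerGraph V).form b = G.form b + 2 * b p := by
  rw [form_eq_of_nodeBit G { G with sign := G.sign.erase p } rfl
    (fun j => if j = p then 2 else 0)]
  · simp
  · intro j
    by_cases h1 : j = p
    · subst h1
      by_cases h3 : j ∈ G.loop <;> simp [nodeBit, hp, h3] <;> decide
    · simp [nodeBit, h1]

theorem form_eraseLoop (G : StabilizerGraph V) {p : V} (hp : p ∈ G.loop) (b : V → ZMod 4) :
    ({ G with loop := G.loop.erase p } : StabilizerGraph V).form b = G.form b - b p := by
  rw [form_eq_of_nodeBit G { G with loop := G.loop.erase p } rfl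
    (fun j => if j = p then -1 else 0)]
  · simp [sub_eq_add_neg]
  · intro j
    by_cases h1 : j = p
    · subst h1
      simp [nodeBit, hp]
    · simp [nodeBit, h1]

/-- Complementation adds the symmetric matrix `N_j T_k + T_j N_k` up to even amounts, where `N` and
`T` are indicators. This matrix has value `2NT` as a form, but also diagonal entries `2` on `N ∩ T`,
which a simple graph cannot carry; these give the subtracted term. -/
theorem form_complementNbrsTo (G : StabilizerGraph V) (p : V) (T : Finset V) {b : V → ZMod 4}
    (hb : ∀ j, b j * b j = b j) :
    (G.complementNbrsTo p T).form b =
      G.form b + 2 * (bitSum (G.nbrs p) b * bitSum T b - bitSum (G.nbrs p ∩ T) b) := by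
  have h := sum_sum_eq_of_two_mul_eq (G.complementNbrsTo p T).adjBit
    (fun j k => G.adjBit j k + (G.adjBit p j * (if k ∈ T then 1 else 0) +
      (if j ∈ T then 1 else 0) * G.adjBit p k))
    (adjBit_comm _) (fun j k => by rw [G.adjBit_comm j k]; ring)
    (fun j k hjk => by
      simp only [adjBit, complementNbrsTo, Xor]
      by_cases h1 : G.graph.Adj j k <;> by_cases h2 : G.graph.Adj p j <;>
        by_cases h3 : G.graph.Adj p k <;> by_cases h4 : k ∈ T <;> by_cases h5 : j ∈ T <;>
        simp [h1, h2, h3, h4, h5, hjk, truthBit_true, truthBit_false] <;> decide) hb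
  have hd : ∀ j, ((G.complementNbrsTo p T).adjBit j j - (G.adjBit j j +
      (G.adjBit p j * (if j ∈ T then 1 else 0) + (if j ∈ T then 1 else 0) * G.adjBit p j))) * b j =
      -2 * ((if j ∈ G.nbrs p ∩ T then 1 else 0) * b j) := by
    intro j
    rw [adjBit_self, adjBit_self]
    by_cases h1 : j ∈ G.nbrs p <;> by_cases h2 : j ∈ T <;> simp [adjBit_eq_ite, h1, h2]
    ring
  simp only [hd, ← Finset.mul_sum, sum_ite_mem_mul] at h
  simp only [add_mul, Finset.sum_add_distrib, sum_sum_mul_mul, sum_ite_mem_mul] at h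
  have hn : (G.complementNbrsTo p T).nodeBit = G.nodeBit := rfl
  have hN : ∑ j, G.adjBit p j * b j = bitSum (G.nbrs p) b := by
    simp only [adjBit_eq_ite, sum_ite_mem_mul]
  rw [form, form, h, hn, hN]
  ring

/-- The added matrix is `N_j N_k`, with value `N²`; its diagonal, of value `N`, has to be taken
away. Advancing the loops of the neighbors later restores it. -/
theorem form_localComplement (G : StabilizerGraph V) (p : V) {b : V → ZMod 4}
    (hb : ∀ j, b j * b j = b j) :
    (G.localComplement p).form b =
      G.form b + (bitSum (G.nbrs p) b ^ 2 - bitSum (G.nbrs p) b) := by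
  have h := sum_sum_eq_of_two_mul_eq (G.localComplement p).adjBit
    (fun j k => G.adjBit j k + G.adjBit p j * G.adjBit p k)
    (adjBit_comm _) (fun j k => by rw [G.adjBit_comm j k]; ring)
    (fun j k hjk => by
      simp only [adjBit, localComplement, Xor]
      by_cases h1 : G.graph.Adj j k <;> by_cases h2 : G.graph.Adj p j <;>
        by_cases h3 : G.graph.Adj p k <;>
        simp [h1, h2, h3, hjk, truthBit_true, truthBit_false]
      decide) hb
  have hd : ∀ j, ((G.localComplement p).adjBit j j - (G.adjBit j j +
      G.adjBit p j * G.adjBit p j)) * b j =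
      -1 * ((if j ∈ G.nbrs p then 1 else 0) * b j) := by
    intro j
    rw [adjBit_self, adjBit_self]
    by_cases h1 : j ∈ G.nbrs p <;> simp [adjBit_eq_ite, h1]
  simp only [hd, ← Finset.mul_sum, sum_ite_mem_mul] at h
  simp only [add_mul, Finset.sum_add_distrib, sum_sum_mul_mul] at h
  have hn : (G.localComplement p).nodeBit = G.nodeBit := rfl
  have hN : ∑ j, G.adjBit p j * b j = bitSum (G.nbrs p) b := by
    simp only [adjBit_eq_ite, sum_ite_mem_mul]
  rw [form, form, h, hn, hN]
  ring

theorem form_reconnect (G : StabilizerGraph V) {p : V} {T : Finset V} (hp : p ∉ T)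
    (b : V → ZMod 4) :
    (G.reconnect p T).form b =
      G.form b + 2 * b p * (bitSum T b - bitSum (G.nbrs p) b) := by
  have h : ∀ j k, (G.reconnect p T).adjBit j k = G.adjBit j k +
      (if j = p then 1 else 0) * ((if k ∈ T then 1 else 0) - if k ∈ G.nbrs p then 1 else 0) +
      ((if j ∈ T then 1 else 0) - if j ∈ G.nbrs p then 1 else 0) * (if k = p then 1 else 0) := by
    intro j k
    simp only [← adjBit_eq_ite, adjBit, reconnect]
    by_cases hj : j = p
    · subst hj
      by_cases hk : k = j
      · subst hk; simp [hp, truthBit_false]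
      · by_cases hT : k ∈ T <;> simp [hk, hT, truthBit_true, truthBit_false]
    · by_cases hk : k = p
      · subst hk
        by_cases hT : j ∈ T <;>
          simp [hj, hT, G.graph.adj_comm j k, truthBit_true, truthBit_false]
      · simp [hj, hk]
  have h' : ∑ j, (if j = p then 1 else 0) * b j = b p := by simp
  have hn : (G.reconnect p T).nodeBit = G.nodeBit := rfl
  simp only [form, hn, h, add_mul, Finset.sum_add_distrib, sum_sum_mul_mul, sub_mul,
    Finset.sum_sub_distrib, sum_ite_mem_mul, h']
  ring

/-- No node is its own neighbor, so the form is affine in the entry at `p`, with the displayed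
slope. -/
theorem form_update (G : StabilizerGraph V) (p : V) (b : V → ZMod 4) (z : ZMod 4) :
    G.form (Function.update b p z) =
      G.form b + (z - b p) * (G.nodeBit p + 2 * bitSum (G.nbrs p) b) := by
  have hu : ∀ j, Function.update b p z j = b j + (if j = p then 1 else 0) * (z - b p) := by
    intro j
    by_cases hj : j = p
    · subst hj; simp
    · simp [hj]
  have h1 : ∑ j, G.nodeBit j * ((if j = p then 1 else 0) * (z - b p)) =
      G.nodeBit p * (z - b p) := by simp
  have h2 : ∑ j, ∑ k, G.adjBit j k * (b j * ((if k = p then 1 else 0) * (z - b p))) =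
      (z - b p) * bitSum (G.nbrs p) b := by
    rw [← sum_ite_mem_mul, Finset.mul_sum]
    refine Finset.sum_congr rfl fun j _ => ?_
    simp only [ite_mul, one_mul, zero_mul, mul_ite, mul_zero, Finset.sum_ite_eq',
      Finset.mem_univ, if_true]
    rw [G.adjBit_comm, adjBit_eq_ite]
    split_ifs <;> ring
  have h3 : ∑ j, ∑ k, G.adjBit j k * ((if j = p then 1 else 0) * (z - b p) * b k) =
      (z - b p) * bitSum (G.nbrs p) b := by
    rw [← h2, Finset.sum_comm]
    refine Finset.sum_congr rfl fun j _ => Finset.sum_congr rfl fun k _ => ?_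
    rw [G.adjBit_comm]; ring
  have h4 : ∑ j, ∑ k, G.adjBit j k * ((if j = p then 1 else 0) * (z - b p) *
      ((if k = p then 1 else 0) * (z - b p))) = 0 := by
    refine Finset.sum_eq_zero fun j _ => Finset.sum_eq_zero fun k _ => ?_
    split_ifs with h h'
    · subst h; subst h'; simp [adjBit_self]
    all_goals simp
  simp only [form, hu, mul_add, add_mul, Finset.sum_add_distrib]
  simp only [h1, h2, h3, h4]
  ring

end StabilizerGraph

/-! ## Tensor products of one-qubit operators -/

theorem tensorOp_mul {V : Type*} [Fintype V] [DecidableEq V]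
    (A B : V → Matrix (Fin 2) (Fin 2) ℂ) :
    tensorOp A * tensorOp B = tensorOp fun j => A j * B j := by
  ext x y
  simp only [tensorOp, Matrix.mul_apply, Matrix.of_apply]
  rw [Finset.prod_univ_sum, Fintype.piFinset_univ]
  simp only [Finset.prod_mul_distrib]

theorem tensorOp_one {V : Type*} [Fintype V] [DecidableEq V] :
    tensorOp (fun _ : V => 1) = 1 := by
  ext x y
  simp only [tensorOp, Matrix.of_apply, Matrix.one_apply, Finset.prod_ite_zero,
    Finset.prod_const_one, funext_iff, Finset.mem_univ, true_implies]

theorem tensorOp_conjTranspose {V : Type*} [Fintype V] (A : V → Matrix (Fin 2) (Fin 2) ℂ) :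
    (tensorOp A)ᴴ = tensorOp fun j => (A j)ᴴ := by
  ext x y
  simp [tensorOp, Matrix.conjTranspose_apply, star_prod]

/-- The action of a tensor product of monomial one-qubit operators. -/
theorem tensorOp_mulVec_of_monomial {V : Type*} [Fintype V] [DecidableEq V]
    (A : V → Matrix (Fin 2) (Fin 2) ℂ) (σ : V → Fin 2 → Fin 2) (d : V → Fin 2 → ℂ)
    (h : ∀ j a c, A j a c = if c = σ j a then d j a else 0) (f : QState V) (y : V → Fin 2) :
    (tensorOp A *ᵥ f) y = (∏ j, d j (y j)) * f fun j => σ j (y j) := by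
  simp only [Matrix.mulVec, dotProduct, tensorOp, Matrix.of_apply, h, Finset.prod_ite_zero,
    Finset.mem_univ, true_implies, ite_mul, zero_mul]
  rw [Finset.sum_eq_single fun j => σ j (y j)]
  · simp
  · intro z _ hz
    rw [if_neg fun h' => hz (funext h')]
  · simp

/-- The action of a one-qubit operator at the node `p`. -/
theorem tensorOp_single_mulVec {V : Type*} [Fintype V] [DecidableEq V] (p : V)
    (A : Matrix (Fin 2) (Fin 2) ℂ) (f : QState V) (y : V → Fin 2) :
    (tensorOp (fun j => if j = p then A else 1) *ᵥ f) y =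
      A (y p) 0 * f (Function.update y p 0) + A (y p) 1 * f (Function.update y p 1) := by
  have h : ∀ z : V → Fin 2, ∏ j, (if j = p then A else 1) (y j) (z j) =
      ∑ a : Fin 2, if z = Function.update y p a then A (y p) a else 0 := by
    intro z
    rw [← Finset.mul_prod_erase _ _ (Finset.mem_univ p), if_pos rfl,
      Finset.sum_eq_single_of_mem (z p) (Finset.mem_univ _)]
    · by_cases hz : z = Function.update y p (z p)
      · rw [if_pos hz, Finset.prod_eq_one, mul_one]
        intro j hj
        have hj' := Finset.ne_of_mem_erase hj
        rw [if_neg hj', hz, Function.update_of_ne hj', Matrix.one_apply_eq]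
      · rw [if_neg hz]
        obtain ⟨j, hj⟩ : ∃ j, z j ≠ Function.update y p (z p) j := by
          by_contra! hc
          exact hz (funext hc)
        have hj' : j ≠ p := by
          rintro rfl
          simp at hj
        rw [Function.update_of_ne hj'] at hj
        rw [Finset.prod_eq_zero (Finset.mem_erase.2 ⟨hj', Finset.mem_univ j⟩), mul_zero]
        rw [if_neg hj', Matrix.one_apply_ne hj.symm]
    · intro a _ ha
      rw [if_neg]
      rintro rfl
      simp at ha
  simp only [Matrix.mulVec, dotProduct, tensorOp, Matrix.of_apply, h, Fin.sum_univ_two, add_mul,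
    Finset.sum_add_distrib, ite_mul, zero_mul, Finset.sum_ite_eq', Finset.mem_univ, if_true]

/-! ## Powers of `i` -/

/-- The character `a ↦ i ^ a` of `ℤ / 4`. -/
noncomputable def phase : AddChar (ZMod 4) ℂ := AddChar.zmodChar 4 Complex.I_pow_four

theorem phase_one : phase 1 = Complex.I := by
  rw [phase, AddChar.zmodChar_apply, show (1 : ZMod 4).val = 1 from rfl, pow_one]

theorem phase_two : phase 2 = -1 := by
  rw [phase, AddChar.zmodChar_apply, show (2 : ZMod 4).val = 2 from rfl, Complex.I_sq]

theorem phase_two_mul_natCast (n : ℕ) : phase (2 * n) = (-1) ^ n := by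
  rw [mul_comm, ← nsmul_eq_mul, AddChar.map_nsmul_eq_pow, phase_two]

theorem norm_phase (a : ZMod 4) : ‖phase a‖ = 1 := by
  rw [phase, AddChar.zmodChar_apply, norm_pow, Complex.norm_I, one_pow]

theorem star_phase_mul_phase (a : ZMod 4) : star (phase a) * phase a = 1 := by
  rw [Complex.star_def, Complex.conj_mul', norm_phase]
  simp

/-- The bit assignment `y` with entries in `ℤ / 4`. -/
def bits {V : Type*} (y : V → Fin 2) (j : V) : ZMod 4 := if y j = 1 then 1 else 0

theorem bits_mul_self {V : Type*} (y : V → Fin 2) (j : V) : bits y j * bits y j = bits y j := by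
  unfold bits
  split_ifs <;> simp

theorem bits_update {V : Type*} [DecidableEq V] (y : V → Fin 2) (p : V) (a : Fin 2) :
    bits (Function.update y p a) = Function.update (bits y) p (if a = 1 then 1 else 0) := by
  funext j
  by_cases hj : j = p
  · subst hj; simp [bits]
  · simp [bits, hj]

/-! ## The state of a stabilizer graph -/

/-- The normalization factor of the Hadamard gate. -/
noncomputable def invSqrtTwo : ℂ := ((1 / Real.sqrt 2 : ℝ) : ℂ)

theorem invSqrtTwo_mul_self : invSqrtTwo * invSqrtTwo = 1 / 2 := by
  rw [invSqrtTwo, ← Complex.ofReal_mul, div_mul_div_comm, Real.mul_self_sqrt (by norm_num)]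
  norm_num

theorem star_invSqrtTwo : star invSqrtTwo = invSqrtTwo := by
  rw [invSqrtTwo, Complex.star_def, Complex.conj_ofReal]

theorem Gate.H_apply (a c : Fin 2) :
    Gate.H a c = invSqrtTwo * (if a = 1 ∧ c = 1 then -1 else 1) := by
  fin_cases a <;> fin_cases c <;> simp [Gate.H, invSqrtTwo]

theorem Gate.H_conjTranspose_mul_self : Gate.Hᴴ * Gate.H = 1 := by
  ext a c
  simp only [Matrix.mul_apply, Matrix.conjTranspose_apply, Gate.H_apply, star_mul',
    star_invSqrtTwo, Fin.sum_univ_two]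
  have h := invSqrtTwo_mul_self
  fin_cases a <;> fin_cases c <;> simp <;> linear_combination 2 * h

theorem Gate.Z_mul_H : Gate.Z * Gate.H = Gate.H * Gate.X := by
  ext a c
  fin_cases a <;> fin_cases c <;> simp [Gate.H, Gate.Z, Gate.X, Matrix.mul_apply]

/-- The controlled-`Z` gates along a set of edges multiply `|y⟩` by a power of `i`. -/
theorem noncommProd_CZedge {V : Type*} [Fintype V] [DecidableEq V] (E : Finset (Sym2 V))
    (hE : ∀ e ∈ E, ¬ e.IsDiag)
    (comm : (E : Set (Sym2 V)).Pairwise (Function.onFun Commute (Gate.CZedge (V := V)))) :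
    E.noncommProd Gate.CZedge comm =
      Matrix.diagonal fun y : V → Fin 2 =>
        phase (∑ j, ∑ k, (if s(j, k) ∈ E then 1 else 0) * (bits y j * bits y k)) := by
  induction E using Finset.induction_on with
  | empty => simp
  | insert e E he ih =>
    rw [Finset.noncommProd_insert_of_notMem _ _ _ _ he,
      ih (fun f hf => hE f (Finset.mem_insert_of_mem hf))]
    have hd := hE e (Finset.mem_insert_self e E)
    induction e with
    | _ a c =>
    have hac : a ≠ c := by simpa using hd
    have hz : (Gate.CZedge s(a, c) : QOp V) =
        Matrix.diagonal fun y => phase (2 * (bits y a * bits y c)) := by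
      change Gate.CZ a c = _
      rw [Gate.CZ]
      congr 1
      funext y
      by_cases h1 : y a = 1 <;> by_cases h2 : y c = 1 <;> simp [bits, h1, h2, phase_two]
    rw [hz, Matrix.diagonal_mul_diagonal]
    congr 1
    funext y
    rw [← AddChar.map_add_eq_mul]
    congr 1
    -- The new edge appears at the two distinct ordered positions `(a, c)` and `(c, a)`, which
    -- accounts for the exponent `2 y_a y_c` of its gate.
    have h : ∀ j k, (if s(j, k) ∈ insert s(a, c) E then 1 else 0) * (bits y j * bits y k) =
        (if j = a then if k = c then bits y a * bits y c else 0 else 0) +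
        (if j = c then if k = a then bits y a * bits y c else 0 else 0) +
        (if s(j, k) ∈ E then 1 else 0) * (bits y j * bits y k) := by
      intro j k
      simp only [Finset.mem_insert]
      by_cases h1 : s(j, k) = s(a, c)
      · have h2 : s(j, k) ∉ E := h1 ▸ he
        rw [Sym2.eq_iff] at h1
        rcases h1 with ⟨rfl, rfl⟩ | ⟨rfl, rfl⟩
        · simp [h2, hac]
        · simp [h2, hac, hac.symm, mul_comm]
      · have h1' := h1
        rw [Sym2.eq_iff] at h1'
        push Not at h1'
        have e1 : (if j = a then if k = c then bits y a * bits y c else 0 else 0) = 0 := by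
          split_ifs with i1 i2
          · exact absurd i2 (h1'.1 i1)
          all_goals rfl
        have e2 : (if j = c then if k = a then bits y a * bits y c else 0 else 0) = 0 := by
          split_ifs with i1 i2
          · exact absurd i2 (h1'.2 i1)
          all_goals rfl
        simp [h1, e1, e2]
    simp only [h, Finset.sum_add_distrib]
    simp
    ring

namespace StabilizerGraph

variable {V : Type*} [Fintype V] [DecidableEq V]

/-- The final Hadamard gates at the hollow nodes. -/
noncomputable def hollowOp (T : Finset V) : QOp V :=
  tensorOp fun j => if j ∈ T then Gate.H else 1

/-- The graph state before the final Hadamard gates. -/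
noncomputable def solidState (G : StabilizerGraph V) : QState V :=
  fun y => invSqrtTwo ^ Fintype.card V * phase (G.form (bits y))

/-- The initial Hadamards give a constant vector, and every later gate except the final Hadamards is
diagonal, so only powers of `i` accumulate. -/
theorem state_eq (G : StabilizerGraph V) : G.state = hollowOp G.hollow *ᵥ G.solidState := by
  have h0 : (tensorOp fun _ : V => Gate.H) *ᵥ zeroState V =
      fun _ => invSqrtTwo ^ Fintype.card V := by
    funext y
    simp [zeroState, tensorOp, Gate.H_apply]
  have h1 : tensorOp G.nodeGate = hollowOp G.hollow *
      tensorOp fun j => (if j ∈ G.loop then Gate.S else 1) * (if j ∈ G.sign then Gate.Z else 1) := by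
    rw [hollowOp, tensorOp_mul]
    congr 1
    funext j
    simp only [nodeGate, mul_assoc]
  have hE : ∀ e ∈ G.edges, ¬ e.IsDiag := by
    intro e he
    exact G.graph.not_isDiag_of_mem_edgeSet (by simpa [edges] using he)
  have hc : G.circuit = _ :=
    congrArg (fun D => tensorOp G.nodeGate * D * tensorOp fun _ => Gate.H)
      (noncommProd_CZedge G.edges hE fun e _ f _ _ => Gate.CZedge_commute e f)
  rw [state, hc, h1, ← Matrix.mulVec_mulVec, h0,
    ← Matrix.mulVec_mulVec, ← Matrix.mulVec_mulVec]
  congr 1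
  funext y
  rw [tensorOp_mulVec_of_monomial _ (fun _ a => a)
    (fun j a => phase (G.nodeBit j * if a = 1 then 1 else 0)), Matrix.mulVec_diagonal]
  · have h2 : ∏ j, phase (G.nodeBit j * if y j = 1 then 1 else 0) =
        phase (∑ j, G.nodeBit j * bits y j) := by
      exact (map_prod phase.toMonoidHom (fun j => Multiplicative.ofAdd (G.nodeBit j * bits y j))
        Finset.univ).symm
    have h3 : ∀ j k, (if s(j, k) ∈ G.edges then 1 else 0) = G.adjBit j k := by
      intro j k
      by_cases h : G.graph.Adj j k <;> simp [edges, adjBit, h, truthBit_true, truthBit_false]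
    simp only [h2, h3, solidState, form, AddChar.map_add_eq_mul]
    ring
  · intro j a c
    by_cases h2 : j ∈ G.loop <;> by_cases h3 : j ∈ G.sign <;> fin_cases a <;> fin_cases c <;>
      simp [nodeBit, h2, h3, Gate.S, Gate.Z, phase_one, phase_two, AddChar.map_add_eq_mul]

theorem hollowOp_conjTranspose_mul_self (T : Finset V) : (hollowOp T)ᴴ * hollowOp T = 1 := by
  rw [hollowOp, tensorOp_conjTranspose, tensorOp_mul, ← tensorOp_one]
  congr 1
  funext j
  split_ifs
  · exact Gate.H_conjTranspose_mul_self
  · simp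

theorem star_hollowOp_mulVec_dotProduct (T : Finset V) (f g : QState V) :
    star (hollowOp T *ᵥ f) ⬝ᵥ (hollowOp T *ᵥ g) = star f ⬝ᵥ g := by
  rw [Matrix.star_mulVec, ← Matrix.dotProduct_mulVec, Matrix.mulVec_mulVec,
    hollowOp_conjTranspose_mul_self, Matrix.one_mulVec]

theorem hollowOp_insert {p : V} {T : Finset V} (hp : p ∉ T) :
    hollowOp (insert p T) = hollowOp T * tensorOp fun j => if j = p then Gate.H else 1 := by
  rw [hollowOp, hollowOp, tensorOp_mul]
  congr 1
  funext j
  by_cases hj : j = p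
  · subst hj; simp [hp]
  · simp [hj]

end StabilizerGraph

/-! ### Parities modulo 4 and bit flips -/

theorem natCast_card {V : Type*} [Fintype V] [DecidableEq V] (T : Finset V) :
    (T.card : ZMod 4) = ∑ j, if j ∈ T then 1 else 0 := by
  rw [Finset.sum_boole, Finset.filter_univ_mem]

theorem two_mul_natCast_of_even {n : ℕ} (h : Even n) : 2 * (n : ZMod 4) = 0 := by
  obtain ⟨r, rfl⟩ := h
  push_cast
  have h4 : (4 : ZMod 4) = 0 := rfl
  linear_combination (r : ZMod 4) * h4

theorem two_mul_natCast_of_not_even {n : ℕ} (h : ¬ Even n) : 2 * (n : ZMod 4) = 2 := by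
  obtain ⟨r, rfl⟩ := Nat.not_even_iff_odd.1 h
  push_cast
  have h4 : (4 : ZMod 4) = 0 := rfl
  linear_combination (r : ZMod 4) * h4

/-- Flip the bits of the nodes in `T`. -/
def flipBits {V : Type*} [DecidableEq V] (T : Finset V) (y : V → Fin 2) : V → Fin 2 :=
  fun j => if j ∈ T then y j + 1 else y j

theorem bits_flipBits {V : Type*} [DecidableEq V] (T : Finset V) (y : V → Fin 2) (j : V) :
    bits (flipBits T y) j = bits y j + if j ∈ T then 1 - 2 * bits y j else 0 := by
  have h : ∀ a : Fin 2, (if a + 1 = 1 then (1 : ZMod 4) else 0) =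
      (if a = 1 then 1 else 0) + (1 - 2 * if a = 1 then 1 else 0) := by decide
  by_cases hj : j ∈ T
  · simp only [bits, flipBits, hj, if_true, h]
  · simp [bits, flipBits, hj]

theorem invSqrtTwo_pow_mul_self (n : ℕ) :
    invSqrtTwo ^ n * invSqrtTwo ^ n = (1 / 2) ^ n := by
  rw [← mul_pow, invSqrtTwo_mul_self]

namespace StabilizerGraph

variable {V : Type*} [Fintype V] [DecidableEq V]

/-! ## The measurement of a graph state -/

/-- Polarization: by symmetry of the adjacency matrix the two cross terms coincide. -/
theorem form_add (G : StabilizerGraph V) (b u : V → ZMod 4) :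
    G.form (fun j => b j + u j) = G.form b + ∑ j, G.nodeBit j * u j +
      ∑ j, ∑ k, 2 * (G.adjBit j k * (b j * u k)) + ∑ j, ∑ k, G.adjBit j k * (u j * u k) := by
  have h : ∑ j, ∑ k, G.adjBit j k * (u j * b k) = ∑ j, ∑ k, G.adjBit j k * (b j * u k) := by
    rw [Finset.sum_comm]
    refine Finset.sum_congr rfl fun j _ => Finset.sum_congr rfl fun k _ => ?_
    rw [G.adjBit_comm]; ring
  simp only [form, mul_add, add_mul, Finset.sum_add_distrib, h, ← Finset.mul_sum]
  ring

/-- Flipping adds `1 - 2 y_j` on `MH`. Without loops there, the linear part changes by `2b`. With no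
edges inside `MH`, the quadratic part of the increment vanishes. The cross terms give `2 |MH ∩ N(j)|
y_j`, and combined with the `2 y_j` on `MS` these survive exactly at even counts, i.e. on `MSE`. -/
theorem form_flipBits (G : StabilizerGraph V) (M : PauliProduct V) (hG : G.IsSimplifiedFor M)
    (y : V → Fin 2) :
    G.form (bits (flipBits (G.MH M) y)) + 2 * bitSum (G.MS M) (bits y) =
      G.form (bits y) + 2 * G.signCount M + 2 * bitSum (G.MSE M) (bits y) := by
  have h4 : (4 : ZMod 4) = 0 := rfl
  have h1 : ∑ j, G.nodeBit j * (if j ∈ G.MH M then 1 - 2 * bits y j else 0) =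
      2 * G.signCount M := by
    rw [signCount, natCast_card, Finset.mul_sum]
    refine Finset.sum_congr rfl fun j _ => ?_
    by_cases hj : j ∈ G.MH M
    · have hl := (hG j hj).1
      by_cases hs : j ∈ G.sign <;> simp [nodeBit, hj, hl, hs]
      linear_combination -bits y j * h4
    · simp [hj]
  have h2 : ∀ j, ∑ k, 2 * (G.adjBit j k *
      (bits y j * (if k ∈ G.MH M then 1 - 2 * bits y k else 0))) =
      2 * ((G.MH M ∩ G.nbrs j).card : ZMod 4) * bits y j := by
    intro j
    rw [natCast_card, Finset.mul_sum, Finset.sum_mul]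
    refine Finset.sum_congr rfl fun k _ => ?_
    rw [adjBit_eq_ite]
    by_cases hk : k ∈ G.MH M <;> by_cases hn : k ∈ G.nbrs j <;> simp [hk, hn]
    linear_combination -bits y j * bits y k * h4
  have h3 : ∑ j, ∑ k, G.adjBit j k * ((if j ∈ G.MH M then 1 - 2 * bits y j else 0) *
      (if k ∈ G.MH M then 1 - 2 * bits y k else 0)) = 0 := by
    refine Finset.sum_eq_zero fun j _ => Finset.sum_eq_zero fun k _ => ?_
    by_cases hj : j ∈ G.MH M <;> by_cases hk : k ∈ G.MH M
    · have := (hG j hj).2.1 k hk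
      simp [adjBit, this, truthBit_false]
    all_goals simp [hj, hk]
  have h5 : ∑ j, 2 * ((G.MH M ∩ G.nbrs j).card : ZMod 4) * bits y j +
      2 * bitSum (G.MS M) (bits y) = 2 * bitSum (G.MSE M) (bits y) := by
    rw [← sum_ite_mem_mul, ← sum_ite_mem_mul, Finset.mul_sum, Finset.mul_sum,
      ← Finset.sum_add_distrib]
    refine Finset.sum_congr rfl fun j _ => ?_
    by_cases hj : j ∈ G.MS M
    · by_cases he : Even (G.MH M ∩ G.nbrs j).card
      · have : j ∈ G.MSE M := Finset.mem_filter.2 ⟨hj, he⟩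
        simp [hj, this, two_mul_natCast_of_even he]
      · have : j ∉ G.MSE M := fun h => he (Finset.mem_filter.1 h).2
        simp only [hj, this, two_mul_natCast_of_not_even he, if_true, if_false]
        linear_combination bits y j * h4
    · have : j ∉ G.MSE M := fun h => hj (Finset.mem_filter.1 h).1
      -- A node outside `MS` is unmeasured or in `MH`; the simplification hypothesis excludes
      -- measured hollow neighbors in both cases.
      have he : G.MH M ∩ G.nbrs j = ∅ := by
        refine Finset.eq_empty_of_forall_notMem fun k hk => ?_
        obtain ⟨hk, hn⟩ := Finset.mem_inter.1 hk
        rw [mem_nbrs] at hn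
        by_cases hm : j ∈ M.measured
        · have hh : j ∈ G.hollow := by
            by_contra hh
            exact hj (Finset.mem_sdiff.2 ⟨hm, hh⟩)
          exact (hG k hk).2.1 j (Finset.mem_inter.2 ⟨hm, hh⟩) hn.symm
        · exact (hG k hk).2.2 j hm hn.symm
      simp [hj, this, he]
  have h0 : bits (flipBits (G.MH M) y) =
      fun j => bits y j + if j ∈ G.MH M then 1 - 2 * bits y j else 0 :=
    funext (bits_flipBits _ y)
  rw [h0, form_add, h1, h3, Finset.sum_congr rfl fun j _ => h2 j]
  linear_combination h5

theorem toOp_mul_hollowOp (G : StabilizerGraph V) (M : PauliProduct V) (hZ : M.IsZType) :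
    M.toOp * hollowOp G.hollow = hollowOp G.hollow *
      tensorOp fun j => if j ∈ G.MH M then Gate.X else if j ∈ G.MS M then Gate.Z else 1 := by
  rw [PauliProduct.toOp, hollowOp, tensorOp_mul, tensorOp_mul]
  congr 1
  funext j
  rcases hZ j with h | h <;> by_cases hj : j ∈ G.hollow <;>
    simp [MH, MS, PauliProduct.measured, h, hj, Pauli.toMatrix, Gate.Z_mul_H]

theorem toOp_mulVec_state (G : StabilizerGraph V) (M : PauliProduct V) (hZ : M.IsZType)
    (hG : G.IsSimplifiedFor M) :
    M.toOp *ᵥ G.state = hollowOp G.hollow *ᵥ fun y =>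
      phase (2 * G.signCount M + 2 * bitSum (G.MSE M) (bits y)) * G.solidState y := by
  rw [state_eq, Matrix.mulVec_mulVec, toOp_mul_hollowOp G M hZ, ← Matrix.mulVec_mulVec]
  congr 1
  funext y
  rw [tensorOp_mulVec_of_monomial _ (fun j a => if j ∈ G.MH M then a + 1 else a)
    (fun j a => phase (2 * ((if j ∈ G.MS M then 1 else 0) * if a = 1 then 1 else 0)))]
  · have h : ∏ j, phase (2 * ((if j ∈ G.MS M then 1 else 0) * if y j = 1 then 1 else 0)) =
        phase (2 * bitSum (G.MS M) (bits y)) := by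
      rw [← sum_ite_mem_mul, Finset.mul_sum]
      exact (map_prod phase.toMonoidHom (fun j => Multiplicative.ofAdd
        (2 * ((if j ∈ G.MS M then 1 else 0) * bits y j))) Finset.univ).symm
    change _ * G.solidState (flipBits (G.MH M) y) = _
    rw [h, solidState, solidState, mul_left_comm, ← AddChar.map_add_eq_mul, mul_left_comm,
      ← AddChar.map_add_eq_mul]
    congr 2
    linear_combination form_flipBits G M hG y
  · intro j a c
    by_cases hj : j ∈ G.MH M
    · have hs : j ∉ G.MS M := by
        simp only [MH, Finset.mem_inter] at hj
        simp [MS, hj.2]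
      fin_cases a <;> fin_cases c <;> simp [hj, hs, Gate.X]
    · by_cases hs : j ∈ G.MS M <;> fin_cases a <;> fin_cases c <;>
        simp [hj, hs, Gate.Z, phase_two]

/-! ### Outcome projectors and probabilities -/

theorem outcomeProj_mulVec_state (G : StabilizerGraph V) (M : PauliProduct V) (hZ : M.IsZType)
    (hG : G.IsSimplifiedFor M) (m : ℕ) :
    outcomeProj M.toOp m *ᵥ G.state = hollowOp G.hollow *ᵥ fun y =>
      1 / 2 * (1 + phase (2 * ((m + G.signCount M : ℕ) : ZMod 4) +
        2 * bitSum (G.MSE M) (bits y))) * G.solidState y := by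
  rw [outcomeProj, Matrix.smul_mulVec, Matrix.add_mulVec, Matrix.one_mulVec, Matrix.smul_mulVec,
    toOp_mulVec_state G M hZ hG, state_eq, ← Matrix.mulVec_smul, ← Matrix.mulVec_add,
    ← Matrix.mulVec_smul]
  congr 1
  funext y
  have h : (2 * ((m + G.signCount M : ℕ) : ZMod 4) + 2 * bitSum (G.MSE M) (bits y)) =
      2 * (m : ZMod 4) + (2 * G.signCount M + 2 * bitSum (G.MSE M) (bits y)) := by
    push_cast; ring
  rw [h, AddChar.map_add_eq_mul phase (2 * (m : ZMod 4)), phase_two_mul_natCast]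
  simp only [Pi.smul_apply, Pi.add_apply, smul_eq_mul]
  ring

/-- The Hadamards are unitary and drop out of the inner product; the phases of `solidState` cancel
against their conjugates, leaving an average of signs. -/
theorem outcomeProb_state (G : StabilizerGraph V) (M : PauliProduct V) (hZ : M.IsZType)
    (hG : G.IsSimplifiedFor M) (m : ℕ) :
    outcomeProb M.toOp G.state m = (1 / 2 * (1 + (1 / 2) ^ Fintype.card V *
      (phase (2 * ((m + G.signCount M : ℕ) : ZMod 4)) *
        ∑ y : V → Fin 2, phase (2 * bitSum (G.MSE M) (bits y))))).re := by
  rw [outcomeProb, outcomeProj_mulVec_state G M hZ hG, state_eq, star_hollowOp_mulVec_dotProduct]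
  congr 1
  have h : ∀ y : V → Fin 2, star G.solidState y * (1 / 2 * (1 + phase (2 *
      ((m + G.signCount M : ℕ) : ZMod 4) + 2 * bitSum (G.MSE M) (bits y))) * G.solidState y) =
      1 / 2 * ((1 / 2) ^ Fintype.card V + (1 / 2) ^ Fintype.card V *
        (phase (2 * ((m + G.signCount M : ℕ) : ZMod 4)) *
          phase (2 * bitSum (G.MSE M) (bits y)))) := by
    intro y
    rw [Pi.star_apply, solidState, star_mul', star_pow, star_invSqrtTwo, AddChar.map_add_eq_mul,
      ← invSqrtTwo_pow_mul_self]
    linear_combination (invSqrtTwo ^ Fintype.card V * invSqrtTwo ^ Fintype.card V * (1 / 2) *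
      (1 + phase (2 * ((m + G.signCount M : ℕ) : ZMod 4)) *
        phase (2 * bitSum (G.MSE M) (bits y)))) * star_phase_mul_phase (G.form (bits y))
  rw [dotProduct, Finset.sum_congr rfl fun y _ => h y, ← Finset.mul_sum, Finset.sum_add_distrib,
    ← Finset.mul_sum, ← Finset.mul_sum]
  simp

/-- Flipping the bit at `p` pairs terms of opposite sign. -/
theorem sum_phase_bitSum_eq_zero {T : Finset V} {p : V} (hp : p ∈ T) :
    ∑ y : V → Fin 2, phase (2 * bitSum T (bits y)) = 0 := by
  refine Finset.sum_involution (fun y _ => Function.update y p (y p + 1)) ?_ ?_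
    (fun _ _ => Finset.mem_univ _) ?_
  · intro y _
    have hU : p ∉ T.erase p := Finset.notMem_erase p T
    rw [bits_update, ← Finset.insert_erase hp, bitSum_insert hU, bitSum_insert hU,
      bitSum_update hU, Function.update_self, mul_add, mul_add, AddChar.map_add_eq_mul,
      AddChar.map_add_eq_mul, ← add_mul]
    have : phase (2 * bits y p) + phase (2 * if y p + 1 = 1 then 1 else 0) = 0 := by
      unfold bits
      generalize y p = a
      fin_cases a <;> simp [phase_two]
    rw [this, zero_mul]
  · intro y _ _ h
    have := congrFun h p
    simp at this
  · intro y _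
    have h : ∀ a : Fin 2, a + 1 + 1 = a := by decide
    simp [h]

theorem outcomeProb_of_mem (G : StabilizerGraph V) (M : PauliProduct V) (hZ : M.IsZType)
    (hG : G.IsSimplifiedFor M) {p : V} (hp : p ∈ G.MSE M) (m : ℕ) :
    outcomeProb M.toOp G.state m = 1 / 2 := by
  rw [outcomeProb_state G M hZ hG, sum_phase_bitSum_eq_zero hp]
  simp

theorem outcomeProb_of_eq_empty (G : StabilizerGraph V) (M : PauliProduct V) (hZ : M.IsZType)
    (hG : G.IsSimplifiedFor M) (h : G.MSE M = ∅) (m : ℕ) :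
    outcomeProb M.toOp G.state m =
      (1 / 2 * (1 + phase (2 * ((m + G.signCount M : ℕ) : ZMod 4)))).re := by
  rw [outcomeProb_state G M hZ hG, h, mul_left_comm]
  simp [bitSum]

/-! ## The steps of the measurement procedure -/

/-- The target set omits `p`, so the edges at `p` survive step 1, and the later steps up to the
reconnection still see the original neighbors. -/
theorem nbrs_step1 (G : StabilizerGraph V) (p : V) (T : Finset V) :
    (G.step1 p T).nbrs p = G.nbrs p := by
  ext k
  by_cases h : G.graph.Adj p k
  · simp [mem_nbrs, step1, complementNbrsTo, Xor, h, h.ne]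
  · simp [mem_nbrs, step1, complementNbrsTo, Xor, h]

theorem form_step1 (G : StabilizerGraph V) (p : V) (T : Finset V) {b : V → ZMod 4}
    (hb : ∀ j, b j * b j = b j) :
    (G.step1 p T).form b = G.form b + 2 * (bitSum (G.nbrs p) b * bitSum (T.erase p) b -
      bitSum (G.nbrs p ∩ T.erase p) b) :=
  G.form_complementNbrsTo p (T.erase p) hb

theorem nbrs_step2a (G : StabilizerGraph V) (p : V) (T : Finset V) :
    (G.step2a p T).nbrs p = G.nbrs p := by
  unfold step2a; split_ifs <;> rfl

theorem loop_step2a (G : StabilizerGraph V) (p : V) (T : Finset V) :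
    (G.step2a p T).loop = G.loop := by
  unfold step2a; split_ifs <;> rfl

theorem hollow_step2a (G : StabilizerGraph V) (p : V) (T : Finset V) :
    (G.step2a p T).hollow = G.hollow := by
  unfold step2a; split_ifs <;> rfl

/-- The term on `N ∩ T` cancels the diagonal correction left by step 1. In the signed case it arises
from the excluded neighbors with coefficient `-2`, which is `2` modulo 4. -/
theorem form_step2a (G : StabilizerGraph V) (p : V) (T : Finset V) (b : V → ZMod 4) :
    (G.step2a p T).form b = G.form b + 2 * bitSum (G.nbrs p ∩ T.erase p) b +
      (if p ∈ G.sign then 1 else 0) * (2 * b p + 2 * bitSum (T.erase p) b) := by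
  have h4 : (4 : ZMod 4) = 0 := rfl
  unfold step2a
  by_cases h : p ∈ G.sign
  · rw [if_neg (not_not.2 h), if_pos h, form_flipSigns, form_eraseSign G h, bitSum_sdiff]
    linear_combination -bitSum (G.nbrs p ∩ T.erase p) b * h4
  · have hN : G.nbrs p ∩ T = G.nbrs p ∩ T.erase p := by
      rw [Finset.inter_erase, Finset.erase_eq_of_notMem]
      simp [notMem_nbrs_self]
    rw [if_pos h, if_neg h, form_flipSigns, hN]
    ring

theorem nbrs_step2b (G : StabilizerGraph V) (p : V) (P : Prop) :
    (G.step2b p P).nbrs p = G.nbrs p := by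
  unfold step2b; split_ifs <;> rfl

theorem loop_step2b (G : StabilizerGraph V) (p : V) (P : Prop) :
    (G.step2b p P).loop = G.loop := by
  unfold step2b; split_ifs <;> rfl

theorem hollow_step2b (G : StabilizerGraph V) (p : V) (P : Prop) :
    (G.step2b p P).hollow = G.hollow := by
  unfold step2b; split_ifs <;> rfl

theorem form_step2b (G : StabilizerGraph V) (p : V) (P : Prop) (b : V → ZMod 4) :
    (G.step2b p P).form b =
      G.form b + truthBit P * (2 * b p + 2 * bitSum (G.nbrs p) b) := by
  unfold step2b truthBit
  split_ifs
  · rw [form_flipSigns, bitSum_insert (G.notMem_nbrs_self p)]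
    ring
  · ring

/-- Step 4 therefore complements and advances on `T.erase p`, which turns its contribution into the
square of `bitSum (T.erase p)`. -/
theorem nbrs_step3 (G : StabilizerGraph V) (p : V) (T : Finset V) :
    (G.step3 p T).nbrs p = T.erase p := by
  ext k
  by_cases h : k = p <;> simp [mem_nbrs, step3, reconnect, h]

theorem form_step3 (G : StabilizerGraph V) (p : V) (T : Finset V) (b : V → ZMod 4) :
    (G.step3 p T).form b =
      G.form b + 2 * b p * (bitSum (T.erase p) b - bitSum (G.nbrs p) b) :=
  G.form_reconnect (Finset.notMem_erase p T) b

theorem hollow_step4 (G : StabilizerGraph V) (p : V) (T : Finset V) (P : Prop) :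
    (G.step4 p T P).hollow = G.hollow := by
  unfold step4; split_ifs <;> rfl

theorem form_step4 (G : StabilizerGraph V) (p : V) (T : Finset V) (P : Prop) {b : V → ZMod 4}
    (hb : ∀ j, b j * b j = b j) :
    (G.step4 p T P).form b = G.form b + (if p ∈ G.loop then 1 else 0) *
      (bitSum (G.nbrs p) b ^ 2 - b p + truthBit P * (2 * bitSum (T.erase p) b)) := by
  have h : p ∈ G.loop → (G.step4a p).form b = G.form b + bitSum (G.nbrs p) b ^ 2 - b p := by
    intro hp
    have hN : ({ G with loop := G.loop.erase p } : StabilizerGraph V).nbrs p = G.nbrs p := rfl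
    rw [step4a, form_advanceLoops, form_localComplement _ p hb, form_eraseLoop G hp, hN]
    ring
  unfold step4 truthBit
  by_cases hp : p ∈ G.loop
  · rw [if_pos hp, if_pos hp]
    split_ifs
    · rw [form_flipSigns, h hp]
      ring
    · rw [h hp]
      ring
  · rw [if_neg hp, if_neg hp]
    ring

theorem hollow_measureGraph (G : StabilizerGraph V) (M : PauliProduct V) (p : V) (m : ℕ) :
    (G.measureGraph M p m).hollow = insert p G.hollow := by
  rw [measureGraph, hollow_step4, step3]
  change insert p (step2b _ _ _).hollow = _
  rw [hollow_step2b, hollow_step2a]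
  rfl

theorem form_measureGraph (G : StabilizerGraph V) (M : PauliProduct V) (p : V) (m : ℕ)
    {b : V → ZMod 4} (hb : ∀ j, b j * b j = b j) :
    (G.measureGraph M p m).form b = G.form b +
      2 * bitSum (G.nbrs p) b * bitSum ((G.MSE M).erase p) b +
      (if p ∈ G.sign then 1 else 0) * (2 * b p + 2 * bitSum ((G.MSE M).erase p) b) +
      truthBit (¬ m ≡ G.signCount M [MOD 2]) * (2 * b p + 2 * bitSum (G.nbrs p) b) +
      2 * b p * (bitSum ((G.MSE M).erase p) b - bitSum (G.nbrs p) b) +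
      (if p ∈ G.loop then 1 else 0) * (bitSum ((G.MSE M).erase p) b ^ 2 - b p +
        truthBit (¬ m ≡ G.signCount M [MOD 2]) * (2 * bitSum ((G.MSE M).erase p) b)) := by
  have hl : ∀ (K : StabilizerGraph V) (T : Finset V), (K.step3 p T).loop = K.loop :=
    fun _ _ => rfl
  have hl1 : (G.step1 p (G.MSE M)).loop = G.loop := rfl
  have hs1 : (G.step1 p (G.MSE M)).sign = G.sign := rfl
  rw [measureGraph, form_step4 _ _ _ _ hb, nbrs_step3, form_step3, form_step2b, form_step2a,
    form_step1 _ _ _ hb, nbrs_step2b, nbrs_step2a, nbrs_step1]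
  simp only [hl, loop_step2b, loop_step2a, hl1, hs1]
  ring

/-- The two halves of the sum defining the Hadamard gate at the chosen node. -/
theorem form_measureGraph_update (G : StabilizerGraph V) (M : PauliProduct V) {p : V}
    (hp : p ∈ G.MSE M) (m : ℕ) {b : V → ZMod 4} (hb : ∀ j, b j * b j = b j) {z : ZMod 4}
    (hz : z * z = z) :
    (G.measureGraph M p m).form (Function.update b p z) = G.form b + z * (2 *
      (truthBit (¬ m ≡ G.signCount M [MOD 2]) + bitSum ((G.MSE M).erase p) b)) +
      (2 * truthBit (¬ m ≡ G.signCount M [MOD 2]) * bitSum (G.nbrs p) b +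
      2 * (bitSum (G.nbrs p) b + (if p ∈ G.sign then 1 else 0)) *
        (bitSum ((G.MSE M).erase p) b - b p) +
      (if p ∈ G.loop then 1 else 0) * (bitSum ((G.MSE M).erase p) b ^ 2 - b p +
        truthBit (¬ m ≡ G.signCount M [MOD 2]) * (2 * bitSum ((G.MSE M).erase p) b))) := by
  have hb' : ∀ j, Function.update b p z j * Function.update b p z j =
      Function.update b p z j := by
    intro j
    by_cases hj : j = p
    · subst hj; simpa using hz
    · simpa [hj] using hb j
  have h4 : (4 : ZMod 4) = 0 := rfl
  rw [form_measureGraph G M p m hb', form_update, bitSum_update (G.notMem_nbrs_self p),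
    bitSum_update (Finset.notMem_erase p _), Function.update_self, nodeBit]
  -- The loop, sign and neighbor terms in `z` all cancel: `p` has lost its loop, sign and old edges.
  -- The sign cancels only modulo 4, as `2zσ + 2zσ`.
  linear_combination (z * (if p ∈ G.sign then 1 else 0)) * h4

end StabilizerGraph

/-! ### The post-measurement state -/

theorem two_mul_truthBit_not_modEq (m n : ℕ) :
    2 * truthBit (¬ m ≡ n [MOD 2]) = 2 * ((m + n : ℕ) : ZMod 4) := by
  by_cases h : m ≡ n [MOD 2]
  · rw [two_mul_natCast_of_even (n := m + n) (by rw [Nat.even_iff]; unfold Nat.ModEq at h; omega)]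
    simp [h, truthBit_false]
  · rw [two_mul_natCast_of_not_even (n := m + n)
      (by rw [Nat.even_iff]; unfold Nat.ModEq at h; omega)]
    simp [h, truthBit_true]

theorem truthBit_mul_self (P : Prop) : truthBit P * truthBit P = truthBit P := by
  unfold truthBit
  split_ifs <;> simp

namespace StabilizerGraph

variable {V : Type*} [Fintype V] [DecidableEq V]

/-- The cancellation modulo 4 behind the measurement procedure: once the parity of the measured
bits is fixed, the phase does not depend on the bit assignment. -/
theorem phase_exponent_eq {x s u σ l n : ZMod 4} (hx : x * x = x) (hs : s * s = s)
    (h : 2 * s + 2 * (x + u) = 0) :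
    2 * s * n + 2 * (n + σ) * (u - x) + l * (u ^ 2 - x + s * (2 * u)) =
      2 * s * σ - l * s := by
  -- Modulo 4, `u ^ 2` is the parity bit of `u`. The constraint says that `x` is the parity of `s +
  -- u`, so `x = s + u ^ 2 - 2 * s * u`.
  have h1 : ∀ x s u : ZMod 4, x * x = x → s * s = s → 2 * s + 2 * (x + u) = 0 →
      u ^ 2 - x + s * (2 * u) = -s ∧ 2 * (u - x) = 2 * s := by decide
  obtain ⟨h2, h3⟩ := h1 x s u hx hs h
  have h4 : (4 : ZMod 4) = 0 := rfl
  linear_combination (n + σ) * h3 + l * h2 + s * n * h4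

/-- The state of the graph produced by the measurement procedure. -/
theorem state_measureGraph (G : StabilizerGraph V) (M : PauliProduct V) {p : V}
    (hp : p ∈ G.MSE M) (m : ℕ) :
    ∃ a : ZMod 4, (G.measureGraph M p m).state = phase a • (hollowOp G.hollow *ᵥ fun y =>
      invSqrtTwo * (1 + phase (2 * ((m + G.signCount M : ℕ) : ZMod 4) +
        2 * bitSum (G.MSE M) (bits y))) * G.solidState y) := by
  have hph : p ∉ G.hollow := by
    have := (Finset.mem_filter.1 hp).1
    exact (Finset.mem_sdiff.1 this).2
  set s := truthBit (¬ m ≡ G.signCount M [MOD 2]) with hs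
  -- This is the constant value that `phase_exponent_eq` gives to the exponent `K` on the surviving
  -- bit assignments.
  refine ⟨2 * s * (if p ∈ G.sign then 1 else 0) - (if p ∈ G.loop then 1 else 0) * s, ?_⟩
  rw [state_eq, hollow_measureGraph, hollowOp_insert hph, ← Matrix.mulVec_mulVec,
    ← Matrix.mulVec_smul]
  congr 1
  funext y
  have hb := bits_mul_self y
  have hT : bitSum (G.MSE M) (bits y) = bits y p + bitSum ((G.MSE M).erase p) (bits y) := by
    conv_lhs => rw [← Finset.insert_erase hp]
    exact bitSum_insert (Finset.notMem_erase p _) _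
  rw [tensorOp_single_mulVec, solidState, solidState, bits_update, bits_update,
    form_measureGraph_update G M hp m hb (by simp), form_measureGraph_update G M hp m hb (by simp),
    ← two_mul_truthBit_not_modEq, ← hs]
  have hH : ∀ c : Fin 2, Gate.H (y p) c =
      invSqrtTwo * phase (2 * (bits y p * if c = 1 then 1 else 0)) := by
    intro c
    rw [Gate.H_apply]
    by_cases h1 : y p = 1 <;> by_cases h2 : c = 1 <;> simp [bits, h1, h2, phase_two]
  rw [hH, hH]
  simp only [Pi.smul_apply, smul_eq_mul, solidState, hT]
  set u := bitSum ((G.MSE M).erase p) (bits y)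
  set n := bitSum (G.nbrs p) (bits y)
  set x := bits y p
  have h02 : ∀ a x u : ZMod 4, 2 * a + 2 * (x + u) = 0 ∨ 2 * a + 2 * (x + u) = 2 := by decide
  simp only [AddChar.map_add_eq_mul phase (_ + _) (_ + _ + _)]
  set K := 2 * s * n + 2 * (n + if p ∈ G.sign then 1 else 0) * (u - x) +
    (if p ∈ G.loop then 1 else 0) * (u ^ 2 - x + s * (2 * u)) with hK
  simp only [if_true, zero_ne_one, if_false, mul_one, mul_zero, one_mul, zero_mul, add_zero,
    AddChar.map_zero_eq_one]
  have hsum : phase (2 * x) * phase (G.form (bits y) + 2 * (s + u)) =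
      phase (G.form (bits y)) * phase (2 * s + 2 * (x + u)) := by
    rw [← AddChar.map_add_eq_mul, ← AddChar.map_add_eq_mul]
    congr 1
    ring
  -- Either the parity constraint holds and `K` is the constant, or the factor `1 + phase _` is zero
  -- and `K` does not matter.
  have key : (1 + phase (2 * s + 2 * (x + u))) * phase K =
      (1 + phase (2 * s + 2 * (x + u))) *
        phase (2 * s * (if p ∈ G.sign then 1 else 0) - (if p ∈ G.loop then 1 else 0) * s) := by
    rcases h02 s x u with h | h
    · rw [hK, phase_exponent_eq (hb p) (truthBit_mul_self _) h]
    · rw [h, phase_two]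
      simp
  linear_combination invSqrtTwo * invSqrtTwo ^ Fintype.card V * phase K * hsum +
    invSqrtTwo * invSqrtTwo ^ Fintype.card V * phase (G.form (bits y)) * key

theorem sameState_postState_measureGraph (G : StabilizerGraph V) (M : PauliProduct V)
    (hZ : M.IsZType) (hG : G.IsSimplifiedFor M) {p : V} (hp : p ∈ G.MSE M) (m : ℕ) :
    SameState (postState M.toOp G.state m) (G.measureGraph M p m).state := by
  obtain ⟨a, ha⟩ := G.state_measureGraph M hp m
  refine ⟨phase (-a), norm_phase _, ?_⟩
  rw [ha, smul_smul, ← AddChar.map_add_eq_mul, neg_add_cancel, AddChar.map_zero_eq_one, one_smul,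
    postState, outcomeProb_of_mem G M hZ hG hp, outcomeProj_mulVec_state G M hZ hG,
    ← Matrix.mulVec_smul]
  congr 1
  funext y
  -- Normalizing by the probability `1/2` turns the factor `1/2` of the projector into the `1/√2` of
  -- the Hadamard at `p`.
  have h : (((Real.sqrt (1 / 2))⁻¹ : ℝ) : ℂ) * (1 / 2) = invSqrtTwo := by
    have h2 : (Real.sqrt (1 / 2))⁻¹ * (1 / 2) = 1 / Real.sqrt 2 := by
      rw [Real.sqrt_div zero_le_one, Real.sqrt_one, one_div, inv_inv,
        mul_one_div, Real.sqrt_div_self]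
    rw [invSqrtTwo, ← h2]
    push_cast
    rfl
  simp only [Pi.smul_apply, smul_eq_mul]
  rw [← h]
  ring

end StabilizerGraph

theorem mainTheorem2 {V : Type*} [Fintype V] [DecidableEq V] (G : StabilizerGraph V)
    (M : PauliProduct V) (hZ : M.IsZType) (hG : G.IsSimplifiedFor M) :
    -- the outcome is `(-1)^b` with certainty exactly when `MSE` is empty
    (outcomeProb M.toOp G.state (G.signCount M) = 1 ↔ G.MSE M = ∅) ∧
    -- and in that case the state is unchanged
    (G.MSE M = ∅ →
      outcomeProb M.toOp G.state (G.signCount M + 1) = 0 ∧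
      postState M.toOp G.state (G.signCount M) = G.state) ∧
    -- otherwise both outcomes `(-1)^m` have probability `1/2`, and for every choice of the chosen
    -- node the graph produced by the four steps represents the post-measurement state
    (G.MSE M ≠ ∅ → ∀ m : ℕ,
      outcomeProb M.toOp G.state m = 1 / 2 ∧
      ∀ p ∈ G.MSE M,
        SameState (postState M.toOp G.state m) (G.measureGraph M p m).state) := by
  -- The sign of `P_m` depends on `m + b`: it is `+1` for `m = b` and `-1` for `m = b + 1`.
  have heven : 2 * ((G.signCount M + G.signCount M : ℕ) : ZMod 4) = 0 :=
    two_mul_natCast_of_even ⟨_, rfl⟩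
  have hodd : 2 * ((G.signCount M + 1 + G.signCount M : ℕ) : ZMod 4) = 2 :=
    two_mul_natCast_of_not_even (by rw [Nat.even_iff]; omega)
  have hone : G.MSE M = ∅ → outcomeProb M.toOp G.state (G.signCount M) = 1 := by
    intro h
    rw [G.outcomeProb_of_eq_empty M hZ hG h, heven, AddChar.map_zero_eq_one]
    norm_num
  refine ⟨⟨fun h => ?_, hone⟩, fun h => ⟨?_, ?_⟩, fun h m => ⟨?_, fun p hp =>
    G.sameState_postState_measureGraph M hZ hG hp m⟩⟩
  · by_contra hne
    obtain ⟨p, hp⟩ := Finset.nonempty_iff_ne_empty.2 hne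
    rw [G.outcomeProb_of_mem M hZ hG hp] at h
    norm_num at h
  · rw [G.outcomeProb_of_eq_empty M hZ hG h, hodd, phase_two]
    simp
  · rw [postState, hone h, G.outcomeProj_mulVec_state M hZ hG, heven, h, G.state_eq]
    simp only [Real.sqrt_one, inv_one, Complex.ofReal_one, one_smul]
    congr 1
    funext y
    simp only [bitSum, Finset.sum_empty, mul_zero, add_zero, AddChar.map_zero_eq_one]
    ring
  · obtain ⟨p, hp⟩ := Finset.nonempty_iff_ne_empty.2 h
    exact G.outcomeProb_of_mem M hZ hG hp m
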